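/- **Setting.** Let $K$ be a non-archimedean local field with ring of integers $O_K$, uniformiser $\pi$, residue field $k=O_K/\pi O_K$ of cardinality $q$, and normalised absolute value, $|\pi|=1/q$. Equip $K^n$ with the maximum norm and with the product Haar measure $|dx|$ for which $O_K^n$ has measure $1$. Let $X$ be a compact $K$-analytic $n$-manifold, and let $\omega$ be a nowhere vanishing analytic differential $n$-form on $X$. Let $\mathcal A$ be a finite analytic atlas of $X$ with the equalising property: its transition maps take sufficiently small balls to balls of equal radius. Writing $\omega=f_U\,dx_1\wedge\dots\wedge dx_n$ in a chart $(U,\phi_U)\in\mathcal A$, let $\mu_\omega$ be the measure on $X$ with $\mu_\omega(A)=\int_{\phi_U(A)}|f_U(x)|\,|dx|$ for measurable $A\subseteq U$. A *ball* of $X$ is a set $B\subseteq X$ contained in the domain of some chart of $\mathcal A$, and such that, for a common radius $r>0$, every $(U,\phi_U)\in\mathcal A$ with $B\subseteq U$ maps $B$ onto a ball of radius $r$ in $K^n$. If $x,y\in X$ lie in a common ball, $x\wedge y$ denotes the intersection of all balls containing $x$ and $y$; otherwise $x\wedge y$ does not exist. For $s\in\mathbb R$ put $k_0(x,y)=\mu_\omega(x\wedge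 y)^{-s}$ if $x\wedge y$ exists, $k_0(x,y)=1$ otherwise, and $$\Delta_0^s u(x)=\int_X k_0(x,y)\,(u(x)-u(y))\,d\mu_\omega(y)$$ for locally constant $u\colon X\to\mathbb C$. Fix a unitary additive character $\chi$ of $K$ that is trivial on $O_K$ and non-trivial on $\pi^{-1}O_K$, and a map $\eta\colon k^n\to O_K^n$ choosing representatives modulo $\pi$. A *Kozyrev wavelet* on $K^n$ is a function $$\mu(D)^{-1/2}\,\chi\bigl(\pi^{d-1}\,\eta(j)\cdot x\bigr)\,1_D(x),$$ where $D\subset K^n$ is a ball of radius $q^d$, $d\in\mathbb Z$, $j\in k^n\setminus\{0\}$, $\mu$ is the Haar measure and $\cdot$ is the standard scalar product. A *wavelet* on $X$ with support the ball $B$ is a function $\psi\colon X\to\mathbb C$ which vanishes outside $B$ and which, in every chart $(U,\phi_U)\in\mathcal A$ with $B\subseteq U$, is a Kozyrev wavelet supported on $\phi_U(B)$. **Proposition.** Let $s\in\mathbb R$ and let $\psi$ be a wavelet on $X$ with support $B$. Assume that $|f_U|$ is constant on $\phi_U(B)$ for every $(U,\phi_U)\in\mathcal A$ with $B\subseteq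 U$ (so that $\mu_\omega$ is, on $B$, a multiple of Haar measure), and that for every $x\in B$ there is a largest ball $U(x)$ of $X$ containing $x$, i.e. a ball that contains every ball through $x$. Then $\psi$ is an eigenfunction of $\Delta_0^s$: it is a non-zero locally constant function, the integrals defining $\Delta_0^s\psi$ converge absolutely, and $\Delta_0^s\psi=\lambda_\psi\psi$. For every $x\in B$ the eigenvalue is the real number $$\lambda_\psi=\mu_\omega(X\setminus U(x))+\int_{U(x)\setminus B}\mu_\omega(x\wedge y)^{-s}\,d\mu_\omega(y)+\mu_\omega(B)^{1-s},$$ the integral being absolutely convergent. -/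

import Mathlib

open MeasureTheory Set Filter Topology
open scoped Manifold ContDiff NNReal ENNReal

noncomputable section

namespace PadicManifold

section Field

variable (K : Type*) [NontriviallyNormedField K] [IsUltrametricDist K]

/-- The ring of integers `O_K` of a non-archimedean normed field. -/
abbrev Integers : ValuationSubring K := (NormedField.valuation (K := K)).valuationSubring

/-- The residue field `k = O_K / π O_K`. -/
abbrev Residue : Type _ := IsLocalRing.ResidueField (Integers K)

variable {K}

/-- `π` generates the maximal ideal of `O_K`, and the absolute value of `K` is the normalised one:
`|π| = 1 / q` with `q` the number of elements of the residue field. -/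
structure IsNormalisedUniformizer (π : K) : Prop where
  ne_zero : π ≠ 0
  norm_lt_one : ‖π‖ < 1
  norm_le : ∀ x : K, ‖x‖ < 1 → ‖x‖ ≤ ‖π‖
  norm_eq : ‖π‖ = (Nat.card (Residue K) : ℝ)⁻¹

/-- A unitary additive character of `K` that is trivial on `O_K` but not on `π⁻¹ O_K`.
(Such a character is automatically continuous.) -/
structure IsUnramifiedCharacter (π : K) (χ : AddChar K Circle) : Prop where
  trivial_on_integers : ∀ x : K, ‖x‖ ≤ 1 → χ x = 1
  nontrivial : ∃ x : K, ‖x‖ ≤ ‖π‖⁻¹ ∧ χ x ≠ 1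

/-- `η` chooses representatives in `O_K ^ n` of the elements of `(O_K / π O_K) ^ n`. -/
def IsLift {n : ℕ} (η : (Fin n → Residue K) → (Fin n → Integers K)) : Prop :=
  ∀ (j : Fin n → Residue K) (i : Fin n), IsLocalRing.residue (Integers K) (η j i) = j i

end Field

section Haar

variable (K : Type*) [NontriviallyNormedField K] [ProperSpace K]

/-- The unit ball `O_K` as a compact set with non-empty interior. -/
def unitBall : TopologicalSpace.PositiveCompacts K where
  carrier := Metric.closedBall 0 1
  isCompact' := isCompact_closedBall 0 1
  interior_nonempty' :=
    ⟨0, mem_interior.2 ⟨Metric.ball 0 1, Metric.ball_subset_closedBall, Metric.isOpen_ball,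
      Metric.mem_ball_self one_pos⟩⟩

/-- The product Haar measure `|dx| = |dx_1| ⋯ |dx_n|` on `K ^ n`, where `O_K` has measure `1` for
each `|dx_i|`. -/
def haar (n : ℕ) [MeasurableSpace K] [BorelSpace K] : Measure (Fin n → K) :=
  Measure.pi fun _ => Measure.addHaarMeasure (unitBall K)

end Haar

section Kozyrev

variable {K : Type*} [NontriviallyNormedField K] [IsUltrametricDist K] [ProperSpace K]
  [MeasurableSpace K] [BorelSpace K] {n : ℕ}

/-- The Kozyrev wavelet on `K ^ n` attached to the ball `B(a)` with centre `a` and radius `q ^ d`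
and to the index `j`:
`ψ(x) = μ(B(a)) ^ (-1/2) * χ (π ^ (d - 1) * η(j) x) * 1_{B(a)}(x)`, where `η(j) x` is the standard
scalar product. -/
def kozyrev (π : K) (χ : AddChar K Circle) (η : (Fin n → Residue K) → (Fin n → Integers K))
    (a : Fin n → K) (d : ℤ) (j : Fin n → Residue K) : (Fin n → K) → ℂ :=
  (Metric.closedBall a (‖π‖ ^ (-d))).indicator fun x =>
    (((haar K n).real (Metric.closedBall a (‖π‖ ^ (-d))) ^ (-(1 / 2) : ℝ) : ℝ) : ℂ) *
      (χ (π ^ (d - 1) * ∑ i, (η j i : K) * x i) : ℂ)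

end Kozyrev

section Atlas

variable {K : Type*} [NontriviallyNormedField K] {n : ℕ} {X : Type*} [TopologicalSpace X]

/-- A subset `B` of `X` is a ball (with respect to the atlas `𝒜`) if it is contained in the domain
of some chart, and if there is a common radius `r > 0` such that every chart whose domain contains
`B` maps `B` onto a ball of radius `r` in `K ^ n`. -/
def IsBall (𝒜 : Set (OpenPartialHomeomorph X (Fin n → K))) (B : Set X) : Prop :=
  (∃ φ ∈ 𝒜, B ⊆ φ.source) ∧
    ∃ r : ℝ, 0 < r ∧ ∀ φ ∈ 𝒜, B ⊆ φ.source → ∃ a, φ '' B = Metric.closedBall a r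

/-- `x ∧ y` exists, i.e. some ball contains both `x` and `y`. -/
def HasJoin (𝒜 : Set (OpenPartialHomeomorph X (Fin n → K))) (x y : X) : Prop :=
  ∃ B, IsBall 𝒜 B ∧ x ∈ B ∧ y ∈ B

/-- The join `x ∧ y`: the intersection of all balls that contain `x` and `y`. -/
def join (𝒜 : Set (OpenPartialHomeomorph X (Fin n → K))) (x y : X) : Set X :=
  ⋂₀ {B | IsBall 𝒜 B ∧ x ∈ B ∧ y ∈ B}

variable [ChartedSpace (Fin n → K) X]

/-- `𝒜` is a finite atlas of the analytic manifold `X` with the equalising property: the transition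
maps between its charts take sufficiently small balls to balls of equal radius. -/
structure IsEqualisingAtlas (𝒜 : Set (OpenPartialHomeomorph X (Fin n → K))) : Prop where
  finite : 𝒜.Finite
  analytic : 𝒜 ⊆ IsManifold.maximalAtlas 𝓘(K, Fin n → K) ω X
  cover : ∀ x : X, ∃ φ ∈ 𝒜, x ∈ φ.source
  equalising : ∀ φ ∈ 𝒜, ∀ φ' ∈ 𝒜, ∀ a ∈ (φ.symm.trans φ').source,
    ∃ ε : ℝ, 0 < ε ∧ Metric.closedBall a ε ⊆ (φ.symm.trans φ').source ∧
      ∀ (b : Fin n → K) (r : ℝ), 0 < r → Metric.closedBall b r ⊆ Metric.closedBall a ε →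
        ∃ c, (φ.symm.trans φ') '' Metric.closedBall b r = Metric.closedBall c r

variable (K n X) in
/-- Differential `n`-forms on the `n`-manifold `X` (without any regularity). -/
abbrev TopForm : Type _ :=
  (x : X) → (TangentSpace 𝓘(K, Fin n → K) x) [⋀^Fin n]→L[K] K

/-- The coefficient `f_φ` of the form in the chart `φ`, i.e. the function on the image of `φ` such
that the form is `f_φ dx_1 ∧ ⋯ ∧ dx_n` there: the value of the form on the images of the
standard basis vectors under the derivative of `φ⁻¹`. -/
def coeff (θ : TopForm K n X) (φ : OpenPartialHomeomorph X (Fin n → K)) (y : Fin n → K) : K :=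
  θ (φ.symm y) fun i =>
    mfderiv 𝓘(K, Fin n → K) 𝓘(K, Fin n → K) φ.symm y (Pi.single i 1 : Fin n → K)

/-- The form is analytic: so are its coefficients in all charts of the manifold. -/
def IsAnalyticForm (θ : TopForm K n X) : Prop :=
  ∀ φ ∈ IsManifold.maximalAtlas 𝓘(K, Fin n → K) ω X, AnalyticOnNhd K (coeff θ φ) φ.target

/-- The function `|f_φ|` is constant on the image of `B`, for every chart `φ` in `𝒜` whose domain
contains `B`. In other words, in such a chart the measure of the form is, on `B`, a multiple of the
Haar measure. -/
def HasConstantDensity (𝒜 : Set (OpenPartialHomeomorph X (Fin n → K))) (θ : TopForm K n X)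
    (B : Set X) : Prop :=
  ∀ φ ∈ 𝒜, B ⊆ φ.source → ∃ c : ℝ, ∀ x ∈ B, ‖coeff θ φ (φ x)‖ = c

variable [ProperSpace K] [MeasurableSpace K] [BorelSpace K] [MeasurableSpace X]

/-- The measure `A ↦ ∫_{φ(A ∩ U)} |f_φ| |dx|` that the form defines on the domain `U` of the chart
`φ`, extended by zero to `X`. -/
def chartMeasure (θ : TopForm K n X) (φ : OpenPartialHomeomorph X (Fin n → K)) : Measure X :=
  (((haar K n).restrict φ.target).withDensity fun y => ‖coeff θ φ y‖ₑ).map φ.symm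

/-- The measure `μ_θ = |θ|` on `X` that the form defines. It is glued from the measures
on the charts: as these agree on overlaps, the glued measure is their least upper bound. -/
def formMeasure (𝒜 : Set (OpenPartialHomeomorph X (Fin n → K))) (θ : TopForm K n X) : Measure X :=
  ⨆ φ ∈ 𝒜, chartMeasure θ φ

open Classical in
/-- The kernel `k_0(x, y)`, which is `μ_θ(x ∧ y) ^ (-s)` if `x ∧ y` exists, and `1` otherwise. -/
def kernel (𝒜 : Set (OpenPartialHomeomorph X (Fin n → K))) (θ : TopForm K n X) (s : ℝ)
    (x y : X) : ℝ :=
  if HasJoin 𝒜 x y then (formMeasure 𝒜 θ).real (join 𝒜 x y) ^ (-s) else 1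

/-- The operator `Δ_0 ^ s u(x) = ∫_X k_0(x, y) (u(x) - u(y)) dμ_θ(y)`. -/
def laplacian (𝒜 : Set (OpenPartialHomeomorph X (Fin n → K))) (θ : TopForm K n X) (s : ℝ)
    (u : X → ℂ) (x : X) : ℂ :=
  ∫ y, (kernel 𝒜 θ s x y : ℂ) * (u x - u y) ∂(formMeasure 𝒜 θ)

/-- `u` is an eigenfunction of `Δ_0 ^ s` with eigenvalue `l`: it is a non-zero element of the space
of locally constant functions, the integrals defining `Δ_0 ^ s u` exist, and
`Δ_0 ^ s u = l u`. -/
structure IsEigenfunction (𝒜 : Set (OpenPartialHomeomorph X (Fin n → K))) (θ : TopForm K n X)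
    (s : ℝ) (u : X → ℂ) (l : ℂ) : Prop where
  locallyConstant : IsLocallyConstant u
  ne_zero : u ≠ 0
  integrable : ∀ x,
    Integrable (fun y => (kernel 𝒜 θ s x y : ℂ) * (u x - u y)) (formMeasure 𝒜 θ)
  eigen : ∀ x, laplacian 𝒜 θ s u x = l * u x

end Atlas

section Wavelet

variable {K : Type*} [NontriviallyNormedField K] [IsUltrametricDist K] [ProperSpace K]
  [MeasurableSpace K] [BorelSpace K] {n : ℕ} {X : Type*} [TopologicalSpace X]

/-- `ψ` is a wavelet on `X` with support `B`: `B` is a ball of `X`, `ψ` vanishes outside `B`, and in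
each chart whose domain contains `B` it is a Kozyrev wavelet supported on the image of `B`, with
index `j ≠ 0`. -/
structure IsWavelet (𝒜 : Set (OpenPartialHomeomorph X (Fin n → K))) (π : K) (χ : AddChar K Circle)
    (η : (Fin n → Residue K) → (Fin n → Integers K)) (ψ : X → ℂ) (B : Set X) : Prop where
  isBall : IsBall 𝒜 B
  support_eq : Function.support ψ = B
  kozyrev_in_charts : ∀ φ ∈ 𝒜, B ⊆ φ.source →
    ∃ (a : X) (d : ℤ) (j : Fin n → Residue K), a ∈ B ∧ j ≠ 0 ∧
      φ '' B = Metric.closedBall (φ a) (‖π‖ ^ (-d)) ∧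
      ∀ x ∈ φ.source, ψ x = kozyrev π χ η (φ a) d j (φ x)

end Wavelet

end PadicManifold

end

/-! Two facts drive the proof. First, every ball through a point `x` of `B` lies in `U(x)`, hence in
the domain of a single chart, where ultrametric balls are nested or disjoint. So a ball through a
point of `B` and a point `z` outside `B` contains `B` (`subset_of_mem_of_notMem`), and `k_0(x, z)`
is the same for all `x` in `B`. Second, `ψ` has mean zero (`integral_kozyrev`,
`IsWavelet.setIntegral_eq_zero`), because a suitable translation of the support multiplies a Kozyrev
wavelet by a constant other than `1`.

At a point outside `B` the kernel is constant on the support of `ψ`, so the integral is a multiple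
of the mean of `ψ` and vanishes. At `x ∈ B`, split `X` into the complement of `U(x)`, `U(x) \ B` and
`B`. On the first two pieces `ψ(y) = 0`, which gives the first two terms of the eigenvalue. On `B`,
discreteness of the absolute value gives `x ∧ y = B` or `ψ(x) = ψ(y)` (`IsWavelet.join_eq_or_eq`);
hence the kernel may be replaced by `μ(B)^(-s)`, and mean zero leaves `μ(B)^(1-s) ψ(x)`.

All this needs the glued measure to be computable in one chart (`formMeasure_eq_chartMeasure`):
equalising transition maps preserve Haar measure (`map_restrict_source_haar`) and the absolute value
of the density (`norm_coeff_eq`). -/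

namespace PadicManifold

/-! ### Equalising maps preserve Haar measure. -/

section HaarTransport

variable {K : Type*} [NontriviallyNormedField K] [ProperSpace K]
  [MeasurableSpace K] [BorelSpace K] {n : ℕ}

instance isAddHaarMeasure_haar : (haar K n).IsAddHaarMeasure := by
  unfold haar; infer_instance

lemma haar_closedBall_eq (a b : Fin n → K) (r : ℝ) :
    haar K n (Metric.closedBall a r) = haar K n (Metric.closedBall b r) := by
  have h : (fun x => (a - b) + x) ⁻¹' Metric.closedBall a r = Metric.closedBall b r := by
    ext x
    simp only [mem_preimage, Metric.mem_closedBall, dist_eq_norm]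
    rw [show a - b + x - a = x - b by abel]
  rw [← h, measure_preimage_add]

variable [IsUltrametricDist K]

lemma generateFrom_closedBall_eq_borel :
    (inferInstance : MeasurableSpace (Fin n → K)) =
      MeasurableSpace.generateFrom
        {S | S = ∅ ∨ ∃ (b : Fin n → K) (r : ℝ), 0 < r ∧ S = Metric.closedBall b r} := by
  have hb : TopologicalSpace.IsTopologicalBasis
      {S | S = ∅ ∨ ∃ (b : Fin n → K) (r : ℝ), 0 < r ∧ S = Metric.closedBall b r} := by
    refine TopologicalSpace.isTopologicalBasis_of_isOpen_of_nhds ?_ ?_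
    · rintro S (rfl | ⟨b, r, hr, rfl⟩)
      · exact isOpen_empty
      · exact IsUltrametricDist.isOpen_closedBall b hr.ne'
    · intro a V ha hV
      obtain ⟨r, hr, h⟩ := Metric.nhds_basis_closedBall.mem_iff.1 (hV.mem_nhds ha)
      exact ⟨_, Or.inr ⟨a, r, hr, rfl⟩, Metric.mem_closedBall_self hr.le, h⟩
  rw [← hb.borel_eq_generateFrom]
  exact BorelSpace.measurable_eq

omit [ProperSpace K] [MeasurableSpace K] [BorelSpace K] in
-- Two ultrametric balls meet in the smaller one or not at all; the empty set is admitted for the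
-- second case.
lemma isPiSystem_closedBall :
    IsPiSystem {S | S = ∅ ∨ ∃ (b : Fin n → K) (r : ℝ), 0 < r ∧ S = Metric.closedBall b r} := by
  rintro S hS T hT -
  rcases hS with rfl | ⟨b, r, hr, rfl⟩
  · left; simp
  rcases hT with rfl | ⟨c, t, ht, rfl⟩
  · left; simp
  rcases IsUltrametricDist.closedBall_subset_trichotomy b c r t with h | h | h
  · rw [inter_eq_left.2 h]; exact Or.inr ⟨b, r, hr, rfl⟩
  · rw [inter_eq_right.2 h]; exact Or.inr ⟨c, t, ht, rfl⟩
  · exact Or.inl (disjoint_iff_inter_eq_empty.1 h)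

/-- `g` is injective on the ball and takes its sub-balls to balls of the same radius. -/
structure IsEqualisingOn (g : (Fin n → K) → (Fin n → K)) (a : Fin n → K) (ε : ℝ) : Prop where
  pos : 0 < ε
  injOn : InjOn g (Metric.closedBall a ε)
  continuousOn : ContinuousOn g (Metric.closedBall a ε)
  image : ∀ (b : Fin n → K) (r : ℝ), 0 < r → Metric.closedBall b r ⊆ Metric.closedBall a ε →
    ∃ c, g '' Metric.closedBall b r = Metric.closedBall c r

omit [ProperSpace K] [MeasurableSpace K] [BorelSpace K] in
lemma IsEqualisingOn.image_closedBall {g : (Fin n → K) → (Fin n → K)} {a : Fin n → K} {ε : ℝ}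
    (hg : IsEqualisingOn g a ε) {b : Fin n → K} {r : ℝ} (hr : 0 < r)
    (hb : Metric.closedBall b r ⊆ Metric.closedBall a ε) :
    g '' Metric.closedBall b r = Metric.closedBall (g b) r := by
  obtain ⟨c, hc⟩ := hg.image b r hr hb
  rw [hc]
  refine IsUltrametricDist.closedBall_eq_of_mem ?_
  rw [← hc]
  exact mem_image_of_mem g (Metric.mem_closedBall_self hr.le)

omit [ProperSpace K] [MeasurableSpace K] [BorelSpace K] in
lemma IsEqualisingOn.dist_le {g : (Fin n → K) → (Fin n → K)} {a : Fin n → K} {ε : ℝ}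
    (hg : IsEqualisingOn g a ε) {x : Fin n → K} (hx : x ∈ Metric.closedBall a ε) :
    dist (g x) (g a) ≤ dist x a := by
  rcases eq_or_ne x a with rfl | hne
  · simp
  have hm : g x ∈ g '' Metric.closedBall a (dist x a) := mem_image_of_mem g (by simp)
  rw [hg.image_closedBall (dist_pos.2 hne) (Metric.closedBall_subset_closedBall hx)] at hm
  exact hm

/-- Finite measures are determined by their values on a generating π-system, here the balls. A small
ball in the image comes from a ball of the same radius, and Haar measure depends only on the radius.
-/
lemma IsEqualisingOn.map_restrict_haar {g : (Fin n → K) → (Fin n → K)} {a : Fin n → K} {ε : ℝ}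
    (hg : IsEqualisingOn g a ε) :
    ((haar K n).restrict (Metric.closedBall a ε)).map g =
      (haar K n).restrict (g '' Metric.closedBall a ε) := by
  have hE : MeasurableSet (Metric.closedBall a ε) := Metric.isClosed_closedBall.measurableSet
  have him := hg.image_closedBall hg.pos (Subset.refl _)
  have hae : AEMeasurable g ((haar K n).restrict (Metric.closedBall a ε)) :=
    hg.continuousOn.aemeasurable hE
  have : IsFiniteMeasure ((haar K n).restrict (Metric.closedBall a ε)) :=
    ⟨by rw [Measure.restrict_apply_univ]; exact (isCompact_closedBall a ε).measure_lt_top⟩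
  have key : ∀ S, MeasurableSet S → (haar K n) (Metric.closedBall a ε ∩ g ⁻¹' S) =
      (haar K n) (Metric.closedBall (g a) ε ∩ S) →
      (((haar K n).restrict (Metric.closedBall a ε)).map g) S =
      ((haar K n).restrict (g '' Metric.closedBall a ε)) S := by
    intro S hS h
    rw [Measure.map_apply_of_aemeasurable hae hS, Measure.restrict_apply' hE,
      Measure.restrict_apply hS, him, inter_comm, h, inter_comm]
  refine ext_of_generate_finite _ generateFrom_closedBall_eq_borel isPiSystem_closedBall ?_ ?_
  · rintro S (rfl | ⟨b, r, hr, rfl⟩)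
    · simp
    refine key _ Metric.isClosed_closedBall.measurableSet ?_
    rcases IsUltrametricDist.closedBall_subset_trichotomy b (g a) r ε with h | h | h
    · obtain ⟨b', hb', rfl⟩ : b ∈ g '' Metric.closedBall a ε := by
        rw [him]; exact h (Metric.mem_closedBall_self hr.le)
      rw [inter_eq_right.2 h]
      rcases le_total r ε with hrε | hrε
      · have hsub : Metric.closedBall b' r ⊆ Metric.closedBall a ε := by
          rw [IsUltrametricDist.closedBall_eq_of_mem hb']
          exact Metric.closedBall_subset_closedBall hrε
        have hi := hg.image_closedBall hr hsub
        have : Metric.closedBall a ε ∩ g ⁻¹' Metric.closedBall (g b') r =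
            Metric.closedBall b' r := by
          rw [← hi]
          exact hg.injOn.preimage_image_inter hsub |> fun h => by rw [inter_comm]; exact h
        rw [this, haar_closedBall_eq]
      -- A ball does not determine its radius, so containment in the image does not force `r ≤ ε`;
      -- if `ε ≤ r` the two balls coincide.
      · have h2 : Metric.closedBall (g b') r = Metric.closedBall (g a) ε := by
          refine h.antisymm ?_
          have : g b' ∈ Metric.closedBall (g a) ε := h (Metric.mem_closedBall_self hr.le)
          rw [IsUltrametricDist.closedBall_eq_of_mem this]
          exact Metric.closedBall_subset_closedBall hrε
        rw [h2, ← him, inter_eq_left.2 (subset_preimage_image g _), him, haar_closedBall_eq]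
    · rw [inter_eq_left.2 h, inter_eq_left.2, haar_closedBall_eq]
      rw [← him] at h
      exact image_subset_iff.1 h
    · rw [inter_comm, disjoint_iff_inter_eq_empty.1 h.symm]
      have : g ⁻¹' Metric.closedBall b r ∩ Metric.closedBall a ε = ∅ := by
        rw [← disjoint_iff_inter_eq_empty]
        refine disjoint_left.2 fun x hx hx' => disjoint_left.1 h hx ?_
        rw [← him]; exact mem_image_of_mem g hx'
      rw [this]
  · refine key _ MeasurableSet.univ ?_
    rw [preimage_univ, inter_univ, inter_univ, haar_closedBall_eq]

/-- A partial homeomorphism that takes small balls to balls of the same radius preserves the Haar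
measure. -/
lemma map_restrict_source_haar (τ : OpenPartialHomeomorph (Fin n → K) (Fin n → K))
    (hτ : ∀ a ∈ τ.source, ∃ ε, Metric.closedBall a ε ⊆ τ.source ∧ IsEqualisingOn τ a ε) :
    ((haar K n).restrict τ.source).map τ = (haar K n).restrict τ.target := by
  choose! ε hε hg using hτ
  -- Countably many equalising balls suffice, so equality of the two measures can be checked on each
  -- image ball.
  obtain ⟨t, hts, htc, hcov⟩ := TopologicalSpace.countable_cover_nhdsWithin
    (f := fun a => Metric.closedBall a (ε a)) (s := τ.source)
    fun a ha => mem_nhdsWithin_of_mem_nhds (Metric.closedBall_mem_nhds a (hg a ha).pos)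
  have hT : τ.target = ⋃ a ∈ t, τ '' Metric.closedBall a (ε a) := by
    rw [← τ.image_source_eq_target]
    refine Subset.antisymm ?_ ?_
    · rw [← image_iUnion₂]; exact image_mono hcov
    · exact iUnion₂_subset fun a ha => image_mono (hε a (hts ha))
  have hsm : MeasurableSet τ.source := τ.open_source.measurableSet
  have htm : MeasurableSet τ.target := τ.open_target.measurableSet
  have hae : AEMeasurable τ ((haar K n).restrict τ.source) := τ.continuousOn.aemeasurable hsm
  have h1 : (((haar K n).restrict τ.source).map τ).restrict τ.target =
      ((haar K n).restrict τ.target).restrict τ.target := by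
    suffices h : ∀ V, V = ⋃ a ∈ t, τ '' Metric.closedBall a (ε a) →
        (((haar K n).restrict τ.source).map τ).restrict V =
          ((haar K n).restrict τ.target).restrict V from h _ hT
    rintro _ rfl
    refine (Measure.restrict_biUnion_congr htc).2 fun a ha => ?_
    have hga := hg a (hts ha)
    have hsub := hε a (hts ha)
    have hmeas : MeasurableSet (τ '' Metric.closedBall a (ε a)) := by
      rw [hga.image_closedBall hga.pos (Subset.refl _)]
      exact Metric.isClosed_closedBall.measurableSet
    have hpre : τ ⁻¹' (τ '' Metric.closedBall a (ε a)) ∩ τ.source = Metric.closedBall a (ε a) :=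
      τ.injOn.preimage_image_inter hsub
    rw [Measure.restrict_map_of_aemeasurable hae hmeas, Measure.restrict_restrict' hsm, hpre,
      hga.map_restrict_haar, Measure.restrict_restrict hmeas, inter_eq_left.2]
    rw [← τ.image_source_eq_target]
    exact image_mono hsub
  rw [Measure.restrict_restrict htm, inter_self] at h1
  -- The pushforward gives no mass to the complement of the target.
  refine (Measure.restrict_eq_self_of_ae_mem ?_).symm.trans h1
  refine (ae_map_iff (p := fun y => y ∈ τ.target) hae htm).2 ?_
  filter_upwards [ae_restrict_mem hsm] with x hx using τ.map_source hx

end HaarTransport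

/-! ### The density of the form under change of chart. -/

section Coefficients

lemma norm_det_le_one {K : Type*} [NontriviallyNormedField K] [IsUltrametricDist K] {n : ℕ}
    (M : Matrix (Fin n) (Fin n) K) (hM : ∀ i j, ‖M i j‖ ≤ 1) : ‖M.det‖ ≤ 1 := by
  rw [Matrix.det_apply']
  refine IsUltrametricDist.norm_sum_le_of_forall_le_of_nonneg zero_le_one fun σ _ => ?_
  rw [norm_mul, norm_prod]
  refine mul_le_one₀ ?_ (Finset.prod_nonneg fun _ _ => norm_nonneg _)
    (Finset.prod_le_one (fun _ _ => norm_nonneg _) fun _ _ => hM _ _)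
  rcases Int.units_eq_one_or (Equiv.Perm.sign σ) with h | h <;> simp [h]

/-- Precomposing an alternating form of top degree with `T` multiplies it by `det T`, and the matrix
entries of `T` are bounded by `‖T‖`. -/
lemma norm_alternating_comp_le {K : Type*} [NontriviallyNormedField K] [IsUltrametricDist K]
    {n : ℕ} {M : Type*} [AddCommGroup M] [Module K M] (f : M [⋀^Fin n]→ₗ[K] K)
    (L : (Fin n → K) →ₗ[K] M) (T : (Fin n → K) →L[K] (Fin n → K)) (hT : ‖T‖ ≤ 1) :
    ‖f fun i => L (T (Pi.single i 1))‖ ≤ ‖f fun i => L (Pi.single i 1)‖ := by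
  have h := (f.compLinearMap L).eq_smul_basis_det (Pi.basisFun K (Fin n))
  have h2 := congrArg (fun g => g fun i => T (Pi.single i 1)) h
  simp only [Pi.basisFun_det, AlternatingMap.compLinearMap_apply, AlternatingMap.smul_apply,
    Pi.basisFun_apply] at h2
  change (f fun i => L (T (Pi.single i 1))) =
    (f fun i => L (Pi.single i 1)) * Matrix.det (fun i => T (Pi.single i 1)) at h2
  rw [h2, norm_mul]
  refine mul_le_of_le_one_right (norm_nonneg _) (norm_det_le_one _ fun i j => ?_)
  calc ‖T (Pi.single i 1) j‖ ≤ ‖T (Pi.single i 1)‖ := norm_le_pi_norm _ j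
    _ ≤ ‖T‖ * ‖(Pi.single i 1 : Fin n → K)‖ := T.le_opNorm _
    _ ≤ 1 := mul_le_one₀ hT (norm_nonneg _) (by simp [Pi.norm_single])

variable {K : Type*} [NontriviallyNormedField K] {n : ℕ} {X : Type*} [TopologicalSpace X]
  [ChartedSpace (Fin n → K) X]

lemma mdifferentiable_of_mem_maximalAtlas {φ : OpenPartialHomeomorph X (Fin n → K)}
    (hφ : φ ∈ IsManifold.maximalAtlas 𝓘(K, Fin n → K) ω X) :
    φ.MDifferentiable 𝓘(K, Fin n → K) 𝓘(K, Fin n → K) :=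
  ⟨(contMDiffOn_of_mem_maximalAtlas hφ).mdifferentiableOn (by simp),
    (contMDiffOn_symm_of_mem_maximalAtlas hφ).mdifferentiableOn (by simp)⟩

variable [IsManifold 𝓘(K, Fin n → K) ω X]

/-- The derivative of `φ⁻¹` is an isomorphism, so the coefficient is the value of a non-zero top
form on a basis. -/
lemma coeff_ne_zero {θ : TopForm K n X} {φ : OpenPartialHomeomorph X (Fin n → K)}
    (hφ : φ ∈ IsManifold.maximalAtlas 𝓘(K, Fin n → K) ω X) {y : Fin n → K} (hy : y ∈ φ.target)
    (hθ : θ (φ.symm y) ≠ 0) : coeff θ φ y ≠ 0 := by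
  have : IsManifold 𝓘(K, Fin n → K) 1 X := IsManifold.of_le (n := ω) (by simp)
  let L : (Fin n → K) ≃L[K] TangentSpace 𝓘(K, Fin n → K) (φ.symm y) :=
    (mdifferentiable_of_mem_maximalAtlas hφ).symm.mfderiv hy
  let e := (Pi.basisFun K (Fin n)).map L.toLinearEquiv
  have h := (AlternatingMap.map_basis_ne_zero_iff e (θ (φ.symm y)).toAlternatingMap).2
    fun h => hθ (ContinuousAlternatingMap.toAlternatingMap_injective h)
  convert h using 1
  unfold coeff
  change _ = θ (φ.symm y) e
  congr 1
  funext i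
  simp only [e, Module.Basis.map_apply, Pi.basisFun_apply]
  rfl

variable [IsUltrametricDist K]

omit [IsManifold 𝓘(K, Fin n → K) ω X] [IsUltrametricDist K] in
lemma IsEqualisingAtlas.exists_isEqualisingOn {𝒜 : Set (OpenPartialHomeomorph X (Fin n → K))}
    (h𝒜 : IsEqualisingAtlas 𝒜) {φ φ' : OpenPartialHomeomorph X (Fin n → K)} (hφ : φ ∈ 𝒜)
    (hφ' : φ' ∈ 𝒜) {a : Fin n → K} (ha : a ∈ (φ.symm.trans φ').source) :
    ∃ ε, Metric.closedBall a ε ⊆ (φ.symm.trans φ').source ∧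
      IsEqualisingOn (φ.symm.trans φ') a ε := by
  obtain ⟨ε, hε, hsub, him⟩ := h𝒜.equalising φ hφ φ' hφ' a ha
  exact ⟨ε, hsub, hε, (φ.symm.trans φ').injOn.mono hsub,
    (φ.symm.trans φ').continuousOn.mono hsub, him⟩

/-- The transition map is non-expanding from `y` on a small ball, so its derivative has operator
norm at most `1`, and so has its determinant by the ultrametric inequality. The inverse transition
gives the reverse inequality in `norm_coeff_eq`. -/
lemma norm_coeff_le {𝒜 : Set (OpenPartialHomeomorph X (Fin n → K))} (h𝒜 : IsEqualisingAtlas 𝒜)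
    (θ : TopForm K n X) {φ φ' : OpenPartialHomeomorph X (Fin n → K)} (hφ : φ ∈ 𝒜) (hφ' : φ' ∈ 𝒜)
    {y : Fin n → K} (hy : y ∈ (φ.symm.trans φ').source) :
    ‖coeff θ φ y‖ ≤ ‖coeff θ φ' ((φ.symm.trans φ') y)‖ := by
  have : IsManifold 𝓘(K, Fin n → K) 1 X := IsManifold.of_le (n := ω) (by simp)
  set τ := φ.symm.trans φ' with hτdef
  have hyt : y ∈ φ.target := hy.1
  have hys : φ.symm y ∈ φ'.source := hy.2
  have hz : τ y ∈ φ'.target := φ'.map_source hys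
  have hbase : φ'.symm (τ y) = φ.symm y := φ'.left_inv hys
  have hmφ := mdifferentiable_of_mem_maximalAtlas (h𝒜.analytic hφ)
  have hmφ' := mdifferentiable_of_mem_maximalAtlas (h𝒜.analytic hφ')
  have hmτ : MDifferentiableAt 𝓘(K, Fin n → K) 𝓘(K, Fin n → K) τ y :=
    (hmφ.symm.trans hmφ').mdifferentiableAt hy
  have hτ : DifferentiableAt K τ y := mdifferentiableAt_iff_differentiableAt.1 hmτ
  have hT : ‖fderiv K τ y‖ ≤ 1 := by
    obtain ⟨ε, hsub, hε⟩ := h𝒜.exists_isEqualisingOn hφ hφ' hy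
    refine hτ.hasFDerivAt.le_of_lip' zero_le_one ?_
    filter_upwards [Metric.closedBall_mem_nhds y hε.pos] with z hz
    rw [one_mul, ← dist_eq_norm, ← dist_eq_norm]
    exact hε.dist_le hz
  have hev : φ.symm =ᶠ[𝓝 y] φ'.symm ∘ τ := by
    filter_upwards [τ.open_source.mem_nhds hy] with z hz
    exact (φ'.left_inv hz.2).symm
  have hchain : mfderiv 𝓘(K, Fin n → K) 𝓘(K, Fin n → K) φ.symm y =
      (mfderiv 𝓘(K, Fin n → K) 𝓘(K, Fin n → K) φ'.symm (τ y)).comp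
        (mfderiv 𝓘(K, Fin n → K) 𝓘(K, Fin n → K) τ y) := by
    rw [hev.mfderiv_eq]
    exact mfderiv_comp y (hmφ'.symm.mdifferentiableAt hz) hmτ
  -- All tangent spaces are `K ^ n` itself, so the same tuple can be fed to the form at either name
  -- of the base point.
  have hcongr : ∀ (p q : X) (v : Fin n → Fin n → K), p = q → θ p v = θ q v := by
    rintro p _ v rfl; rfl
  let L : (Fin n → K) →L[K] (Fin n → K) :=
    mfderiv 𝓘(K, Fin n → K) 𝓘(K, Fin n → K) φ'.symm (τ y)
  have h1 : coeff θ φ y = θ (φ'.symm (τ y)) fun i => L (fderiv K τ y (Pi.single i 1)) := by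
    rw [← mfderiv_eq_fderiv]
    refine Eq.trans ?_ (hcongr _ _ _ hbase.symm)
    unfold coeff
    rw [hchain]
    rfl
  rw [h1]
  exact norm_alternating_comp_le (θ (φ'.symm (τ y))).toAlternatingMap L.toLinearMap _ hT

lemma norm_coeff_eq {𝒜 : Set (OpenPartialHomeomorph X (Fin n → K))} (h𝒜 : IsEqualisingAtlas 𝒜)
    (θ : TopForm K n X) {φ φ' : OpenPartialHomeomorph X (Fin n → K)} (hφ : φ ∈ 𝒜) (hφ' : φ' ∈ 𝒜)
    {y : Fin n → K} (hy : y ∈ (φ.symm.trans φ').source) :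
    ‖coeff θ φ y‖ = ‖coeff θ φ' ((φ.symm.trans φ') y)‖ := by
  refine (norm_coeff_le h𝒜 θ hφ hφ' hy).antisymm ?_
  have hyt : y ∈ φ.target := hy.1
  have hys : φ.symm y ∈ φ'.source := hy.2
  have hz : (φ.symm.trans φ') y ∈ (φ'.symm.trans φ).source := by
    simp [hyt, hys]
  have h := norm_coeff_le h𝒜 θ hφ' hφ hz
  have he : (φ'.symm.trans φ) ((φ.symm.trans φ') y) = y := by
    simp [hyt, hys]
  rwa [he] at h

end Coefficients

/-! ### The measure of the form, computed in one chart. -/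

section FormMeasure

lemma measurableSet_inter_preimage_of_continuousOn {α β : Type*} [TopologicalSpace α]
    [MeasurableSpace α] [OpensMeasurableSpace α] [TopologicalSpace β] [MeasurableSpace β]
    [BorelSpace β] {f : α → β} {T : Set α} (hf : ContinuousOn f T) (hT : MeasurableSet T)
    {S : Set β} (hS : MeasurableSet S) : MeasurableSet (T ∩ f ⁻¹' S) := by
  have h := hT.subtype_image ((continuousOn_iff_continuous_domRestrict.1 hf).measurable hS)
  rwa [domRestrict_eq, preimage_comp, Subtype.image_preimage_coe] at h

variable {K : Type*} [NontriviallyNormedField K] [ProperSpace K]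
  [MeasurableSpace K] [BorelSpace K] {n : ℕ}
  {X : Type*} [TopologicalSpace X] [MeasurableSpace X] [BorelSpace X]
  [ChartedSpace (Fin n → K) X]
  {𝒜 : Set (OpenPartialHomeomorph X (Fin n → K))} {θ : TopForm K n X}
  {φ φ' : OpenPartialHomeomorph X (Fin n → K)}

lemma aemeasurable_symm (φ : OpenPartialHomeomorph X (Fin n → K)) :
    AEMeasurable φ.symm (((haar K n).restrict φ.target).withDensity fun y => ‖coeff θ φ y‖ₑ) :=
  (φ.continuousOn_symm.aemeasurable φ.open_target.measurableSet).mono_ac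
    (withDensity_absolutelyContinuous _ _)

lemma chartMeasure_apply {S : Set X} (hS : MeasurableSet S) :
    chartMeasure θ φ S = ∫⁻ y in φ.symm ⁻¹' S ∩ φ.target, ‖coeff θ φ y‖ₑ ∂(haar K n) := by
  rw [chartMeasure, Measure.map_apply_of_aemeasurable (aemeasurable_symm φ) hS,
    withDensity_apply', Measure.restrict_restrict' φ.open_target.measurableSet]

lemma chartMeasure_inter_source {S : Set X} (hS : MeasurableSet S) :
    chartMeasure θ φ (S ∩ φ.source) = chartMeasure θ φ S := by
  rw [chartMeasure_apply hS, chartMeasure_apply (hS.inter φ.open_source.measurableSet)]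
  congr 2
  ext y
  simp only [preimage_inter, mem_inter_iff, mem_preimage]
  exact ⟨fun h => ⟨h.1.1, h.2⟩, fun h => ⟨⟨h.1, φ.map_target h.2⟩, h.2⟩⟩

variable [IsUltrametricDist K] [IsManifold 𝓘(K, Fin n → K) ω X]

/-- Change of variables along the transition map: it carries Haar measure to Haar measure and
matches the absolute values of the densities. -/
lemma chartMeasure_eq_of_subset (h𝒜 : IsEqualisingAtlas 𝒜) (hθ : IsAnalyticForm θ)
    (hφ : φ ∈ 𝒜) (hφ' : φ' ∈ 𝒜) {S : Set X} (hS : MeasurableSet S) (hSφ : S ⊆ φ.source)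
    (hSφ' : S ⊆ φ'.source) : chartMeasure θ φ S = chartMeasure θ φ' S := by
  rw [chartMeasure_apply hS, chartMeasure_apply hS]
  set τ := φ.symm.trans φ' with hτ
  set S' := φ'.symm ⁻¹' S ∩ φ'.target with hS'
  have hS'm : MeasurableSet S' := by
    rw [hS', inter_comm]
    exact measurableSet_inter_preimage_of_continuousOn φ'.continuousOn_symm
      φ'.open_target.measurableSet hS
  have hsm : MeasurableSet τ.source := τ.open_source.measurableSet
  have hae : AEMeasurable τ ((haar K n).restrict τ.source) := τ.continuousOn.aemeasurable hsm
  have hmap : ((haar K n).restrict τ.source).map τ = (haar K n).restrict τ.target :=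
    map_restrict_source_haar τ fun a ha => h𝒜.exists_isEqualisingOn hφ hφ' ha
  have hsub : S' ⊆ τ.target := by
    rintro z ⟨hz1, hz2⟩
    simp only [hτ, OpenPartialHomeomorph.trans_target, OpenPartialHomeomorph.symm_target,
      mem_inter_iff, mem_preimage]
    exact ⟨hz2, hSφ hz1⟩
  have hpre : τ ⁻¹' S' ∩ τ.source = φ.symm ⁻¹' S ∩ φ.target := by
    ext y
    constructor
    · rintro ⟨h1, h2⟩
      have hl : φ'.symm (τ y) = φ.symm y := φ'.left_inv h2.2
      refine ⟨?_, h2.1⟩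
      have := h1.1
      rwa [mem_preimage, hl] at this
    · rintro ⟨h1, h2⟩
      have hy : y ∈ τ.source := ⟨h2, hSφ' h1⟩
      have hl : φ'.symm (τ y) = φ.symm y := φ'.left_inv hy.2
      refine ⟨⟨?_, φ'.map_source hy.2⟩, hy⟩
      rwa [mem_preimage, hl]
  have h1 : (haar K n).restrict S' =
      ((haar K n).restrict (φ.symm ⁻¹' S ∩ φ.target)).map τ := by
    rw [← hpre, ← Measure.restrict_restrict' hsm,
      ← Measure.restrict_map_of_aemeasurable hae hS'm, hmap,
      Measure.restrict_restrict hS'm, inter_eq_left.2 hsub]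
  have hsub2 : φ.symm ⁻¹' S ∩ φ.target ⊆ τ.source := hpre ▸ inter_subset_right
  rw [h1, lintegral_map']
  · refine setLIntegral_congr_fun (by
      rw [inter_comm]
      exact measurableSet_inter_preimage_of_continuousOn φ.continuousOn_symm
        φ.open_target.measurableSet hS) fun y hy => ?_
    simp only [← ofReal_norm]
    rw [norm_coeff_eq h𝒜 θ hφ hφ' (hsub2 hy)]
  · rw [← h1]
    exact (((hθ φ' (h𝒜.analytic hφ')).continuousOn.mono
      (hsub.trans fun z hz => hz.1)).enorm).aemeasurable hS'm
  · exact hae.mono_measure (Measure.restrict_mono hsub2 le_rfl)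

lemma formMeasure_eq_chartMeasure (h𝒜 : IsEqualisingAtlas 𝒜) (hθ : IsAnalyticForm θ)
    (hφ : φ ∈ 𝒜) {S : Set X} (hS : MeasurableSet S) (hSφ : S ⊆ φ.source) :
    formMeasure 𝒜 θ S = chartMeasure θ φ S := by
  refine le_antisymm ?_ (Measure.le_iff.1 (le_iSup₂ (f := fun φ _ => chartMeasure θ φ) φ hφ) S hS)
  -- A supremum of measures is not computed set by set. Instead, the right side is a measure
  -- dominating every chart measure, hence the supremum, and its second summand vanishes on `S`.
  have hle : formMeasure 𝒜 θ ≤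
      chartMeasure θ φ + (formMeasure 𝒜 θ).restrict φ.sourceᶜ := by
    refine iSup₂_le fun φ' hφ' => Measure.le_iff.2 fun T hT => ?_
    have hsm : MeasurableSet φ.source := φ.open_source.measurableSet
    rw [← measure_inter_add_sdiff T hsm, Measure.add_apply, Measure.restrict_apply hT]
    refine add_le_add ?_ ?_
    · rw [← chartMeasure_inter_source (hT.inter hsm),
        ← chartMeasure_eq_of_subset h𝒜 hθ hφ hφ'
          ((hT.inter hsm).inter φ'.open_source.measurableSet)
          (fun x hx => hx.1.2) (fun x hx => hx.2)]
      exact measure_mono fun x hx => hx.1.1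
    · exact Measure.le_iff.1 (le_iSup₂ (f := fun φ _ => chartMeasure θ φ) φ' hφ') _
        (hT.diff hsm)
  refine (Measure.le_iff.1 hle S hS).trans ?_
  rw [Measure.add_apply, Measure.restrict_apply hS,
    (disjoint_compl_right_iff_subset.2 hSφ).inter_eq, measure_empty, add_zero]

/-- By compactness it suffices to bound the measure near each point, where the density is continuous
on a compact ball. -/
lemma formMeasure_isFiniteMeasure [CompactSpace X] (h𝒜 : IsEqualisingAtlas 𝒜)
    (hθ : IsAnalyticForm θ) : IsFiniteMeasure (formMeasure 𝒜 θ) := by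
  refine ⟨isCompact_univ.measure_lt_top_of_nhdsWithin fun x _ => ?_⟩
  obtain ⟨φ, hφ, hx⟩ := h𝒜.cover x
  obtain ⟨r, hr, hrt⟩ := Metric.nhds_basis_closedBall.mem_iff.1
    (φ.open_target.mem_nhds (φ.map_source hx))
  set V := φ.source ∩ φ ⁻¹' Metric.closedBall (φ x) r with hV
  have hVm : MeasurableSet V := measurableSet_inter_preimage_of_continuousOn φ.continuousOn
    φ.open_source.measurableSet Metric.isClosed_closedBall.measurableSet
  refine ⟨V, mem_nhdsWithin_of_mem_nhds (inter_mem (φ.open_source.mem_nhds hx)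
    ((φ.continuousAt hx).preimage_mem_nhds (Metric.closedBall_mem_nhds _ hr))), ?_⟩
  rw [formMeasure_eq_chartMeasure h𝒜 hθ hφ hVm inter_subset_left, chartMeasure_apply hVm]
  obtain ⟨C, hC⟩ := (isCompact_closedBall (φ x) r).exists_bound_of_continuousOn
    ((hθ φ (h𝒜.analytic hφ)).continuousOn.mono hrt)
  have hsub : φ.symm ⁻¹' V ∩ φ.target ⊆ Metric.closedBall (φ x) r := by
    rintro y ⟨h1, h2⟩
    have := h1.2
    rwa [mem_preimage, φ.right_inv h2] at this
  calc ∫⁻ y in φ.symm ⁻¹' V ∩ φ.target, ‖coeff θ φ y‖ₑ ∂(haar K n)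
      ≤ ∫⁻ y in Metric.closedBall (φ x) r, ‖coeff θ φ y‖ₑ ∂(haar K n) :=
        lintegral_mono_set hsub
    _ ≤ ∫⁻ y in Metric.closedBall (φ x) r, ENNReal.ofReal C ∂(haar K n) :=
        setLIntegral_mono measurable_const fun y hy => by
          rw [← ofReal_norm]; exact ENNReal.ofReal_le_ofReal (hC y hy)
    _ < ⊤ := by
        rw [setLIntegral_const]
        exact ENNReal.mul_lt_top ENNReal.ofReal_lt_top (isCompact_closedBall _ _).measure_lt_top

/-- Where the density is constant, the measure of the form is a multiple of the Haar measure. -/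
lemma formMeasure_restrict_eq_of_norm_coeff_eq (h𝒜 : IsEqualisingAtlas 𝒜)
    (hθ : IsAnalyticForm θ) (hφ : φ ∈ 𝒜) {B : Set X} (hB : MeasurableSet B)
    (hBφ : B ⊆ φ.source) {c : ℝ} (hc : ∀ x ∈ B, ‖coeff θ φ (φ x)‖ = c) :
    (formMeasure 𝒜 θ).restrict B =
      ENNReal.ofReal c • ((haar K n).restrict (φ '' B)).map φ.symm := by
  have him : φ.symm ⁻¹' B ∩ φ.target = φ '' B := by
    rw [φ.image_eq_target_inter_inv_preimage hBφ, inter_comm]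
  have himm : MeasurableSet (φ '' B) := by
    rw [φ.image_eq_target_inter_inv_preimage hBφ]
    exact measurableSet_inter_preimage_of_continuousOn φ.continuousOn_symm
      φ.open_target.measurableSet hB
  have hsub : φ '' B ⊆ φ.target := by rw [← him]; exact inter_subset_right
  ext S hS
  rw [Measure.restrict_apply hS, formMeasure_eq_chartMeasure h𝒜 hθ hφ (hS.inter hB)
    (inter_subset_right.trans hBφ), chartMeasure_apply (hS.inter hB), Measure.smul_apply,
    Measure.map_apply_of_aemeasurable
      ((φ.continuousOn_symm.mono hsub).aemeasurable himm) hS, Measure.restrict_apply' himm,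
    preimage_inter, inter_assoc, him, smul_eq_mul, ← setLIntegral_const]
  refine setLIntegral_congr_fun (by
    rw [inter_comm]
    exact measurableSet_inter_preimage_of_continuousOn (φ.continuousOn_symm.mono hsub) himm hS) ?_
  rintro _ ⟨-, x, hx, rfl⟩
  simp only [← ofReal_norm]
  rw [hc x hx]

end FormMeasure

/-! ### Kozyrev wavelets on `K ^ n`. -/

section Kozyrev

variable {K : Type*} [NontriviallyNormedField K] [IsUltrametricDist K] {n : ℕ}
  {π : K} {χ : AddChar K Circle} {η : (Fin n → Residue K) → (Fin n → Integers K)}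

lemma norm_integers_le_one (x : Integers K) : ‖(x : K)‖ ≤ 1 := by
  have h := x.2
  rw [Valuation.mem_valuationSubring_iff] at h
  exact_mod_cast h

lemma norm_eq_one_of_residue_ne_zero {x : Integers K}
    (hx : IsLocalRing.residue (Integers K) x ≠ 0) : ‖(x : K)‖ = 1 := by
  obtain ⟨u, rfl⟩ := (IsLocalRing.residue_ne_zero_iff_isUnit x).1 hx
  have h1 := norm_integers_le_one (u : Integers K)
  have h2 := norm_integers_le_one ((u⁻¹ : (Integers K)ˣ) : Integers K)
  have h3 : ‖((u : Integers K) : K)‖ * ‖(((u⁻¹ : (Integers K)ˣ) : Integers K) : K)‖ = 1 := by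
    rw [← norm_mul, ← norm_one (α := K)]
    congr 1
    exact_mod_cast congrArg (Subtype.val) u.mul_inv
  nlinarith [norm_nonneg ((u : Integers K) : K),
    norm_nonneg (((u⁻¹ : (Integers K)ˣ) : Integers K) : K)]

lemma norm_dotProduct_le (c : Fin n → Integers K) (x : Fin n → K) :
    ‖∑ i, (c i : K) * x i‖ ≤ ‖x‖ := by
  refine IsUltrametricDist.norm_sum_le_of_forall_le_of_nonneg (norm_nonneg _) fun i _ => ?_
  rw [norm_mul]
  exact (mul_le_of_le_one_left (norm_nonneg _) (norm_integers_le_one _)).trans (norm_le_pi_norm x i)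

lemma character_add (c : Fin n → Integers K) (p : K) (x v : Fin n → K) :
    χ (p * ∑ i, (c i : K) * (v + x) i) =
      χ (p * ∑ i, (c i : K) * v i) * χ (p * ∑ i, (c i : K) * x i) := by
  rw [← AddChar.map_add_eq_mul]
  congr 1
  simp only [Pi.add_apply, mul_add, Finset.sum_add_distrib]

lemma character_eq_of_norm_sub_le (hπ0 : π ≠ 0) (hχ : IsUnramifiedCharacter π χ)
    (c : Fin n → Integers K) {d : ℤ} {x y : Fin n → K} (hxy : ‖x - y‖ ≤ ‖π‖ ^ (1 - d)) :
    χ (π ^ (d - 1) * ∑ i, (c i : K) * x i) = χ (π ^ (d - 1) * ∑ i, (c i : K) * y i) := by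
  have h := character_add (χ := χ) c (π ^ (d - 1)) y (x - y)
  rw [sub_add_cancel] at h
  rw [h, hχ.trivial_on_integers, one_mul]
  rw [norm_mul, norm_zpow]
  have hp : 0 < ‖π‖ := norm_pos_iff.2 hπ0
  calc ‖π‖ ^ (d - 1) * ‖∑ i, (c i : K) * (x - y) i‖
      ≤ ‖π‖ ^ (d - 1) * ‖π‖ ^ (1 - d) := by
        gcongr
        exact (norm_dotProduct_le c _).trans hxy
    _ = 1 := by rw [← zpow_add₀ hp.ne']; simp

/-- The value group is discrete: after scaling by `π ^ d` each coordinate has norm below `1`, hence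
at most `‖π‖`. -/
lemma norm_le_of_lt_zpow (hπ : IsNormalisedUniformizer π) {d : ℤ} {x : Fin n → K}
    (hx : ‖x‖ < ‖π‖ ^ (-d)) : ‖x‖ ≤ ‖π‖ ^ (1 - d) := by
  have hp : 0 < ‖π‖ := norm_pos_iff.2 hπ.ne_zero
  refine (pi_norm_le_iff_of_nonneg (zpow_nonneg hp.le _)).2 fun i => ?_
  have h1 : ‖x i * π ^ d‖ < 1 := by
    rw [norm_mul, norm_zpow]
    calc ‖x i‖ * ‖π‖ ^ d < ‖π‖ ^ (-d) * ‖π‖ ^ d := by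
          gcongr
          exact (norm_le_pi_norm x i).trans_lt hx
      _ = 1 := by rw [← zpow_add₀ hp.ne']; simp
  have h2 := hπ.norm_le _ h1
  rw [norm_mul, norm_zpow] at h2
  calc ‖x i‖ = ‖x i‖ * ‖π‖ ^ d * ‖π‖ ^ (-d) := by
        rw [mul_assoc, ← zpow_add₀ hp.ne']; simp
    _ ≤ ‖π‖ * ‖π‖ ^ (-d) := by gcongr
    _ = ‖π‖ ^ (1 - d) := by rw [sub_eq_add_neg, zpow_add₀ hp.ne', zpow_one]

lemma exists_character_ne_one (hπ0 : π ≠ 0) (hχ : IsUnramifiedCharacter π χ) (hη : IsLift η)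
    (d : ℤ) {j : Fin n → Residue K} (hj : j ≠ 0) :
    ∃ v : Fin n → K, ‖v‖ ≤ ‖π‖ ^ (-d) ∧ χ (π ^ (d - 1) * ∑ i, (η j i : K) * v i) ≠ 1 := by
  have hp : 0 < ‖π‖ := norm_pos_iff.2 hπ0
  obtain ⟨i, hi⟩ := Function.ne_iff.1 hj
  have hu : ‖(η j i : K)‖ = 1 := norm_eq_one_of_residue_ne_zero (by rw [hη]; exact hi)
  have hu0 : (η j i : K) ≠ 0 := norm_ne_zero_iff.1 (by rw [hu]; exact one_ne_zero)
  obtain ⟨w, hw, hw1⟩ := hχ.nontrivial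
  -- Chosen so that the argument of `χ` becomes exactly `w`; dividing by the unit `η j i` leaves the
  -- norm unchanged.
  refine ⟨Pi.single i (w * π ^ (1 - d) / (η j i : K)), ?_, ?_⟩
  · rw [Pi.norm_single, norm_div, hu, div_one, norm_mul, norm_zpow]
    calc ‖w‖ * ‖π‖ ^ (1 - d) ≤ ‖π‖⁻¹ * ‖π‖ ^ (1 - d) := by gcongr
      _ = ‖π‖ ^ (-d) := by
        rw [← zpow_neg_one, ← zpow_add₀ hp.ne']; congr 1; ring
  · convert hw1 using 2
    rw [Finset.sum_eq_single i (fun k _ hk => by rw [Pi.single_eq_of_ne hk, mul_zero])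
      (fun h => absurd (Finset.mem_univ i) h), Pi.single_eq_same, mul_div_cancel₀ _ hu0,
      mul_comm w, ← mul_assoc, ← zpow_add₀ hπ0]
    simp

variable [ProperSpace K] [MeasurableSpace K] [BorelSpace K]

lemma kozyrev_eq_of_norm_sub_le (hπ0 : π ≠ 0) (hχ : IsUnramifiedCharacter π χ)
    {a : Fin n → K} {d : ℤ} {j : Fin n → Residue K} {x y : Fin n → K}
    (hx : x ∈ Metric.closedBall a (‖π‖ ^ (-d))) (hy : y ∈ Metric.closedBall a (‖π‖ ^ (-d)))
    (hxy : ‖x - y‖ ≤ ‖π‖ ^ (1 - d)) : kozyrev π χ η a d j x = kozyrev π χ η a d j y := by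
  rw [kozyrev, indicator_of_mem hx, indicator_of_mem hy,
    character_eq_of_norm_sub_le hπ0 hχ (η j) hxy]

/-- Kozyrev wavelets have mean zero. -/
lemma integral_kozyrev (hπ0 : π ≠ 0) (hχ : IsUnramifiedCharacter π χ) (hη : IsLift η)
    (a : Fin n → K) (d : ℤ) {j : Fin n → Residue K} (hj : j ≠ 0) :
    ∫ x, kozyrev π χ η a d j x ∂(haar K n) = 0 := by
  obtain ⟨v, hv, hv1⟩ := exists_character_ne_one hπ0 hχ hη d hj
  set ζ := χ (π ^ (d - 1) * ∑ i, (η j i : K) * v i) with hζ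
  have hmem : ∀ x, v + x ∈ Metric.closedBall a (‖π‖ ^ (-d)) ↔
      x ∈ Metric.closedBall a (‖π‖ ^ (-d)) := by
    intro x
    have h : v + x ∈ Metric.closedBall x (‖π‖ ^ (-d)) := by
      simpa [dist_eq_norm] using hv
    constructor
    · intro hx
      rw [IsUltrametricDist.closedBall_eq_of_mem hx, ← IsUltrametricDist.closedBall_eq_of_mem h]
      exact Metric.mem_closedBall_self (by positivity)
    · intro hx
      rwa [IsUltrametricDist.closedBall_eq_of_mem hx]
  have hk : ∀ x, kozyrev π χ η a d j (v + x) = (ζ : ℂ) * kozyrev π χ η a d j x := by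
    intro x
    by_cases hx : x ∈ Metric.closedBall a (‖π‖ ^ (-d))
    · rw [kozyrev, indicator_of_mem hx, indicator_of_mem ((hmem x).2 hx), character_add, hζ]
      push_cast
      ring
    · rw [kozyrev, indicator_of_notMem hx, indicator_of_notMem (fun h => hx ((hmem x).1 h)),
        mul_zero]
  -- Translation by `v` preserves the ball, so the integral equals `ζ` times itself with `ζ ≠ 1`.
  have h := integral_add_left_eq_self (μ := haar K n) (kozyrev π χ η a d j) v
  simp only [hk, integral_const_mul] at h
  have hζ1 : (ζ : ℂ) ≠ 1 := fun h => hv1 (Circle.coe_eq_one.1 h)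
  have h2 : ((ζ : ℂ) - 1) * ∫ x, kozyrev π χ η a d j x ∂(haar K n) = 0 := by
    rw [sub_mul, h]; ring
  exact (mul_eq_zero.1 h2).resolve_left (sub_ne_zero.2 hζ1)

end Kozyrev

/-! ### Balls of `X` and joins. -/

section Balls

variable {K : Type*} [NontriviallyNormedField K] {n : ℕ} {X : Type*} [TopologicalSpace X]
  {𝒜 : Set (OpenPartialHomeomorph X (Fin n → K))} {B C U : Set X} {x y z : X}
  {φ : OpenPartialHomeomorph X (Fin n → K)}

lemma IsBall.exists_image_eq (hC : IsBall 𝒜 C) (hφ : φ ∈ 𝒜) (hCφ : C ⊆ φ.source) :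
    ∃ a r, 0 < r ∧ φ '' C = Metric.closedBall a r := by
  obtain ⟨-, r, hr, h⟩ := hC
  obtain ⟨a, ha⟩ := h φ hφ hCφ
  exact ⟨a, r, hr, ha⟩

lemma join_comm : join 𝒜 x y = join 𝒜 y x := by
  simp only [join, and_comm]

lemma join_subset (hC : IsBall 𝒜 C) (hx : x ∈ C) (hy : y ∈ C) : join 𝒜 x y ⊆ C :=
  sInter_subset_of_mem ⟨hC, hx, hy⟩

lemma image_subset_image_iff_of_subset_source (hB : B ⊆ φ.source) (hC : C ⊆ φ.source) :
    φ '' B ⊆ φ '' C ↔ B ⊆ C :=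
  ⟨fun h x hx => by
    obtain ⟨y, hy, hyx⟩ := h (mem_image_of_mem φ hx)
    rwa [← φ.injOn (hC hy) (hB hx) hyx], fun h => image_mono h⟩

variable [IsUltrametricDist K]

lemma IsBall.isOpen (hC : IsBall 𝒜 C) : IsOpen C := by
  obtain ⟨φ, hφ, hCφ⟩ := hC.1
  obtain ⟨a, r, hr, h⟩ := hC.exists_image_eq hφ hCφ
  rw [← φ.isOpen_image_iff_of_subset_source hCφ, h]
  exact IsUltrametricDist.isOpen_closedBall a hr.ne'

omit [IsUltrametricDist K] in
lemma IsBall.isClosed [ProperSpace K] [T2Space X] (hC : IsBall 𝒜 C) : IsClosed C := by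
  obtain ⟨φ, hφ, hCφ⟩ := hC.1
  obtain ⟨a, r, hr, h⟩ := hC.exists_image_eq hφ hCφ
  have hsub : Metric.closedBall a r ⊆ φ.target := by
    rw [← h, ← φ.image_source_eq_target]; exact image_mono hCφ
  have hC' : C = φ.symm '' Metric.closedBall a r := by
    rw [← h]
    exact (φ.toPartialEquiv.symm_image_image_of_subset_source hCφ).symm
  rw [hC']
  exact ((isCompact_closedBall a r).image_of_continuousOn
    (φ.continuousOn_symm.mono hsub)).isClosed

lemma IsBall.subset_or_subset (hB : IsBall 𝒜 B) (hC : IsBall 𝒜 C) (hφ : φ ∈ 𝒜)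
    (hBφ : B ⊆ φ.source) (hCφ : C ⊆ φ.source) (hxB : x ∈ B) (hxC : x ∈ C) : C ⊆ B ∨ B ⊆ C := by
  obtain ⟨a, r, hr, ha⟩ := hB.exists_image_eq hφ hBφ
  obtain ⟨b, t, ht, hb⟩ := hC.exists_image_eq hφ hCφ
  rw [← image_subset_image_iff_of_subset_source hBφ hCφ,
    ← image_subset_image_iff_of_subset_source hCφ hBφ, ha, hb]
  rcases IsUltrametricDist.closedBall_subset_trichotomy b a t r with h | h | h
  · exact Or.inl h
  · exact Or.inr h
  · refine absurd (mem_image_of_mem φ hxB) (disjoint_left.1 h ?_ |> fun h' => by rwa [ha])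
    rw [← hb]; exact mem_image_of_mem φ hxC

/-- A chart defined on the largest ball through `x` contains all balls through `x`, so they can be
compared in `K ^ n`. -/
lemma subset_or_subset_of_isGreatest (hB : IsBall 𝒜 B) (hxB : x ∈ B)
    (hU : IsGreatest {C : Set X | IsBall 𝒜 C ∧ x ∈ C} U) (hC : IsBall 𝒜 C) (hxC : x ∈ C) :
    C ⊆ B ∨ B ⊆ C := by
  obtain ⟨φ, hφ, hUφ⟩ := hU.1.1.1
  exact hB.subset_or_subset hC hφ ((hU.2 ⟨hB, hxB⟩).trans hUφ) ((hU.2 ⟨hC, hxC⟩).trans hUφ)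
    hxB hxC

lemma subset_of_mem_of_notMem (hB : IsBall 𝒜 B) (hxB : x ∈ B)
    (hU : IsGreatest {C : Set X | IsBall 𝒜 C ∧ x ∈ C} U) (hC : IsBall 𝒜 C) (hxC : x ∈ C)
    (hzC : z ∈ C) (hzB : z ∉ B) : B ⊆ C :=
  (subset_or_subset_of_isGreatest hB hxB hU hC hxC).resolve_left fun h => hzB (h hzC)

variable {V : X → Set X}

/-- A ball through `z` and one point of `B` contains all of `B`. This is what makes the kernel
`k_0(·, z)` constant on `B`. -/
lemma mem_ball_iff_of_notMem (hB : IsBall 𝒜 B)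
    (hV : ∀ x ∈ B, IsGreatest {C : Set X | IsBall 𝒜 C ∧ x ∈ C} (V x)) (hx : x ∈ B) (hy : y ∈ B)
    (hz : z ∉ B) (C : Set X) : (IsBall 𝒜 C ∧ x ∈ C ∧ z ∈ C) ↔ (IsBall 𝒜 C ∧ y ∈ C ∧ z ∈ C) :=
  ⟨fun h => ⟨h.1, subset_of_mem_of_notMem hB hx (hV x hx) h.1 h.2.1 h.2.2 hz hy, h.2.2⟩,
    fun h => ⟨h.1, subset_of_mem_of_notMem hB hy (hV y hy) h.1 h.2.1 h.2.2 hz hx, h.2.2⟩⟩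

lemma join_eq_of_notMem (hB : IsBall 𝒜 B)
    (hV : ∀ x ∈ B, IsGreatest {C : Set X | IsBall 𝒜 C ∧ x ∈ C} (V x)) (hx : x ∈ B) (hy : y ∈ B)
    (hz : z ∉ B) : join 𝒜 x z = join 𝒜 y z := by
  simp only [join, mem_ball_iff_of_notMem hB hV hx hy hz]

lemma hasJoin_iff_of_notMem (hB : IsBall 𝒜 B)
    (hV : ∀ x ∈ B, IsGreatest {C : Set X | IsBall 𝒜 C ∧ x ∈ C} (V x)) (hx : x ∈ B) (hy : y ∈ B)
    (hz : z ∉ B) : HasJoin 𝒜 x z ↔ HasJoin 𝒜 y z := by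
  simp only [HasJoin, mem_ball_iff_of_notMem hB hV hx hy hz]

omit [IsUltrametricDist K] in
lemma hasJoin_comm : HasJoin 𝒜 x y ↔ HasJoin 𝒜 y x := by
  simp only [HasJoin, and_comm]

omit [IsUltrametricDist K] in
lemma eq_of_isGreatest (hB : IsBall 𝒜 B)
    (hV : ∀ x ∈ B, IsGreatest {C : Set X | IsBall 𝒜 C ∧ x ∈ C} (V x)) (hx : x ∈ B)
    (hy : y ∈ B) : V x = V y :=
  Subset.antisymm ((hV y hy).2 ⟨(hV x hx).1.1, (hV x hx).2 ⟨hB, hx⟩ hy⟩)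
    ((hV x hx).2 ⟨(hV y hy).1.1, (hV y hy).2 ⟨hB, hy⟩ hx⟩)

omit [IsUltrametricDist K] in
lemma hasJoin_iff_mem (hU : IsGreatest {C : Set X | IsBall 𝒜 C ∧ x ∈ C} U) :
    HasJoin 𝒜 x y ↔ y ∈ U :=
  ⟨fun ⟨_, hC, hx, hy⟩ => hU.2 ⟨hC, hx⟩ hy, fun hy => ⟨U, hU.1.1, hU.1.2, hy⟩⟩

/-- Every point of an ultrametric ball is a centre, so membership depends only on the distance to
`x` in the chart. -/
lemma IsBall.mem_iff_dist_le (hC : IsBall 𝒜 C) (hφ : φ ∈ 𝒜) (hCφ : C ⊆ φ.source) (hx : x ∈ C) :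
    ∃ r, 0 < r ∧ φ '' C = Metric.closedBall (φ x) r ∧
      ∀ y ∈ φ.source, y ∈ C ↔ dist (φ y) (φ x) ≤ r := by
  obtain ⟨a, r, hr, h⟩ := hC.exists_image_eq hφ hCφ
  have hx' : φ x ∈ Metric.closedBall a r := h ▸ mem_image_of_mem φ hx
  rw [IsUltrametricDist.closedBall_eq_of_mem hx'] at h
  refine ⟨r, hr, h, fun y hy => ?_⟩
  rw [← Metric.mem_closedBall, ← h, φ.injOn.mem_image_iff hCφ hy]

/-- The join of `x` and `y` is locally constant in `y ≠ x`. -/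
lemma eventually_join_eq (hU : IsGreatest {C : Set X | IsBall 𝒜 C ∧ x ∈ C} U) (hy : y ∈ U)
    (hyx : y ≠ x) : ∀ᶠ z in 𝓝 y, join 𝒜 x z = join 𝒜 x y := by
  obtain ⟨φ, hφ, hUφ⟩ := hU.1.1.1
  have hd : 0 < dist (φ y) (φ x) :=
    dist_pos.2 fun h => hyx (φ.injOn (hUφ hy) (hUφ hU.1.2) h)
  have hcont : ∀ᶠ z in 𝓝 y, φ z ∈ Metric.ball (φ y) (dist (φ y) (φ x)) :=
    (φ.continuousAt (hUφ hy)).preimage_mem_nhds (Metric.ball_mem_nhds _ hd)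
  filter_upwards [hcont, φ.open_source.mem_nhds (hUφ hy)] with z hz hzφ
  -- Isosceles triangle: `z` is closer to `y` than `x` is, so `y` and `z` are equally far from `x`
  -- and lie in the same balls through `x`.
  have hdz : dist (φ z) (φ x) = dist (φ y) (φ x) := by
    rw [IsUltrametricDist.dist_eq_max_of_dist_ne_dist (φ z) (φ y) (φ x) (ne_of_lt hz)]
    exact max_eq_right (le_of_lt hz)
  have hiff : ∀ C, (IsBall 𝒜 C ∧ x ∈ C ∧ z ∈ C) ↔ (IsBall 𝒜 C ∧ x ∈ C ∧ y ∈ C) := by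
    refine fun C => and_congr_right fun hC => and_congr_right fun hx => ?_
    obtain ⟨r, -, -, hr⟩ := hC.mem_iff_dist_le hφ ((hU.2 ⟨hC, hx⟩).trans hUφ) hx
    rw [hr z hzφ, hr y (hUφ hy), hdz]
  simp only [join, hiff]

/-- The join of two points of `B` at maximal distance is `B`. -/
lemma join_eq_of_le_dist (hB : IsBall 𝒜 B) (hφ : φ ∈ 𝒜) (hBφ : B ⊆ φ.source)
    (hU : IsGreatest {C : Set X | IsBall 𝒜 C ∧ x ∈ C} U) (hx : x ∈ B) (hy : y ∈ B) {r : ℝ}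
    (hr : φ '' B = Metric.closedBall (φ x) r) (hd : r ≤ dist (φ y) (φ x)) : join 𝒜 x y = B := by
  refine (join_subset hB hx hy).antisymm (subset_sInter ?_)
  rintro C ⟨hC, hxC, hyC⟩
  refine (subset_or_subset_of_isGreatest hB hx hU hC hxC).elim (fun h => ?_) id
  -- As `C` contains `y`, its radius is at least the distance from `x` to `y`, hence at least the
  -- radius of `B`.
  obtain ⟨t, -, hCt, ht⟩ := hC.mem_iff_dist_le hφ (h.trans hBφ) hxC
  rw [← image_subset_image_iff_of_subset_source hBφ (h.trans hBφ), hr, hCt]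
  exact Metric.closedBall_subset_closedBall (hd.trans ((ht y (hBφ hy)).1 hyC))

end Balls

/-! ### Wavelets on `X` and the action of the operator. -/

section Wavelet

variable {K : Type*} [NontriviallyNormedField K] [IsUltrametricDist K] [ProperSpace K]
  [MeasurableSpace K] [BorelSpace K] {n : ℕ}
  {X : Type*} [TopologicalSpace X]
  {𝒜 : Set (OpenPartialHomeomorph X (Fin n → K))}
  {π : K} {χ : AddChar K Circle} {η : (Fin n → Residue K) → (Fin n → Integers K)}
  {ψ : X → ℂ} {B : Set X} {x y : X}

lemma IsWavelet.eq_zero (hψ : IsWavelet 𝒜 π χ η ψ B) (hx : x ∉ B) : ψ x = 0 := by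
  rwa [← hψ.support_eq, Function.notMem_support] at hx

lemma IsWavelet.isLocallyConstant [T2Space X] (hπ0 : π ≠ 0) (hχ : IsUnramifiedCharacter π χ)
    (hψ : IsWavelet 𝒜 π χ η ψ B) : IsLocallyConstant ψ := by
  refine (IsLocallyConstant.iff_eventually_eq ψ).2 fun x => ?_
  by_cases hx : x ∈ B
  · obtain ⟨φ, hφ, hBφ⟩ := hψ.isBall.1
    obtain ⟨a, d, j, -, -, him, hk⟩ := hψ.kozyrev_in_charts φ hφ hBφ
    have hp : 0 < ‖π‖ ^ (1 - d) := zpow_pos (norm_pos_iff.2 hπ0) _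
    filter_upwards [hψ.isBall.isOpen.mem_nhds hx, (φ.continuousAt (hBφ hx)).preimage_mem_nhds
      (Metric.closedBall_mem_nhds _ hp)] with y hy hyx
    rw [hk y (hBφ hy), hk x (hBφ hx)]
    refine kozyrev_eq_of_norm_sub_le hπ0 hχ ?_ ?_ ?_
    · rw [← him]; exact mem_image_of_mem φ hy
    · rw [← him]; exact mem_image_of_mem φ hx
    · rw [← dist_eq_norm]; exact hyx
  · filter_upwards [hψ.isBall.isClosed.isOpen_compl.mem_nhds hx] with y hy
    rw [hψ.eq_zero hx, hψ.eq_zero hy]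

lemma IsWavelet.nonempty (hψ : IsWavelet 𝒜 π χ η ψ B) : B.Nonempty := by
  obtain ⟨φ, hφ, hBφ⟩ := hψ.isBall.1
  obtain ⟨a, -, -, ha, -⟩ := hψ.kozyrev_in_charts φ hφ hBφ
  exact ⟨a, ha⟩

/-- Two points of the support of a wavelet are at maximal distance or the wavelet agrees on them. -/
lemma IsWavelet.join_eq_or_eq (hπ : IsNormalisedUniformizer π) (hχ : IsUnramifiedCharacter π χ)
    (hψ : IsWavelet 𝒜 π χ η ψ B) {U : Set X}
    (hU : IsGreatest {C : Set X | IsBall 𝒜 C ∧ x ∈ C} U) (hx : x ∈ B) (hy : y ∈ B) :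
    join 𝒜 x y = B ∨ ψ x = ψ y := by
  obtain ⟨φ, hφ, hBφ⟩ := hψ.isBall.1
  obtain ⟨a, d, j, -, -, him, hk⟩ := hψ.kozyrev_in_charts φ hφ hBφ
  have hxm : φ x ∈ Metric.closedBall (φ a) (‖π‖ ^ (-d)) := him ▸ mem_image_of_mem φ hx
  have hym : φ y ∈ Metric.closedBall (φ a) (‖π‖ ^ (-d)) := him ▸ mem_image_of_mem φ hy
  rcases le_or_gt (‖π‖ ^ (-d)) (dist (φ y) (φ x)) with h | h
  · left
    rw [IsUltrametricDist.closedBall_eq_of_mem hxm] at him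
    exact join_eq_of_le_dist hψ.isBall hφ hBφ hU hx hy him h
  -- A distance below the radius is at most `‖π‖` times the radius, the scale at which the character
  -- is constant.
  · right
    rw [hk x (hBφ hx), hk y (hBφ hy)]
    rw [dist_comm, dist_eq_norm] at h
    exact kozyrev_eq_of_norm_sub_le hπ.ne_zero hχ hxm hym (norm_le_of_lt_zpow hπ h)

variable [MeasurableSpace X] [BorelSpace X] [T2Space X]
  [ChartedSpace (Fin n → K) X] [IsManifold 𝓘(K, Fin n → K) ω X] {θ : TopForm K n X}

lemma IsWavelet.setIntegral_eq_zero (hπ0 : π ≠ 0) (hχ : IsUnramifiedCharacter π χ)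
    (hη : IsLift η) (h𝒜 : IsEqualisingAtlas 𝒜) (hθ : IsAnalyticForm θ)
    (hψ : IsWavelet 𝒜 π χ η ψ B) (hB : HasConstantDensity 𝒜 θ B) :
    ∫ x in B, ψ x ∂(formMeasure 𝒜 θ) = 0 := by
  obtain ⟨φ, hφ, hBφ⟩ := hψ.isBall.1
  obtain ⟨a, d, j, -, hj, him, hk⟩ := hψ.kozyrev_in_charts φ hφ hBφ
  obtain ⟨c, hc⟩ := hB φ hφ hBφ
  have hsub : φ '' B ⊆ φ.target := by
    rw [← φ.image_source_eq_target]; exact image_mono hBφ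
  have himm : MeasurableSet (φ '' B) := by
    rw [him]; exact Metric.isClosed_closedBall.measurableSet
  rw [formMeasure_restrict_eq_of_norm_coeff_eq h𝒜 hθ hφ hψ.isBall.isOpen.measurableSet hBφ hc,
    integral_smul_measure, integral_map
      ((φ.continuousOn_symm.mono hsub).aemeasurable himm)
      (hψ.isLocallyConstant hπ0 hχ).continuous.aestronglyMeasurable,
    setIntegral_congr_fun (g := kozyrev π χ η (φ a) d j) himm, him,
    setIntegral_eq_integral_of_forall_compl_eq_zero (f := kozyrev π χ η (φ a) d j)
      (fun x hx => indicator_of_notMem hx _),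
    integral_kozyrev hπ0 hχ hη _ _ hj, smul_zero]
  intro z hz
  change ψ (φ.symm z) = _
  rw [hk _ (φ.map_target (hsub hz)), φ.right_inv (hsub hz)]

omit [T2Space X] in
-- Positivity keeps the powers of `μ(B)` with negative exponent under control.
lemma formMeasure_ball_pos (h𝒜 : IsEqualisingAtlas 𝒜) (hθ : IsAnalyticForm θ)
    (hθ0 : ∀ x, θ x ≠ 0) (hBall : IsBall 𝒜 B) (hne : B.Nonempty)
    (hB : HasConstantDensity 𝒜 θ B) : 0 < formMeasure 𝒜 θ B := by
  obtain ⟨φ, hφ, hBφ⟩ := hBall.1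
  obtain ⟨x, hx⟩ := hne
  obtain ⟨c, hc⟩ := hB φ hφ hBφ
  obtain ⟨a, r, hr, him⟩ := hBall.exists_image_eq hφ hBφ
  have hsub : φ '' B ⊆ φ.target := by
    rw [← φ.image_source_eq_target]; exact image_mono hBφ
  have himm : MeasurableSet (φ '' B) := by
    rw [him]; exact Metric.isClosed_closedBall.measurableSet
  have hc0 : 0 < c := by
    rw [← hc x hx]
    exact norm_pos_iff.2 (coeff_ne_zero (h𝒜.analytic hφ) (φ.map_source (hBφ hx)) (hθ0 _))
  rw [← Measure.restrict_apply_univ, formMeasure_restrict_eq_of_norm_coeff_eq h𝒜 hθ hφ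
    hBall.isOpen.measurableSet hBφ hc, Measure.smul_apply,
    Measure.map_apply_of_aemeasurable ((φ.continuousOn_symm.mono hsub).aemeasurable himm)
      MeasurableSet.univ, preimage_univ, Measure.restrict_apply_univ, him, smul_eq_mul]
  exact ENNReal.mul_pos (ENNReal.ofReal_pos.2 hc0).ne' (Metric.measure_closedBall_pos _ _ hr).ne'

variable [CompactSpace X] {V : X → Set X}

omit [T2Space X] in
-- Off `B` the join lies between `B` and `U`, so its measure stays between two positive constants;
-- it is locally constant in `y`, hence measurable.
lemma integrableOn_join_rpow (h𝒜 : IsEqualisingAtlas 𝒜) (hθ : IsAnalyticForm θ)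
    (hBall : IsBall 𝒜 B) (hpos : 0 < formMeasure 𝒜 θ B) (s : ℝ) (hx : x ∈ B) {U : Set X}
    (hU : IsGreatest {C : Set X | IsBall 𝒜 C ∧ x ∈ C} U) :
    IntegrableOn (fun y => (formMeasure 𝒜 θ).real (join 𝒜 x y) ^ (-s)) (U \ B)
      (formMeasure 𝒜 θ) := by
  have := formMeasure_isFiniteMeasure h𝒜 hθ
  have hm : MeasurableSet (U \ B) :=
    hU.1.1.isOpen.measurableSet.diff hBall.isOpen.measurableSet
  have hb : 0 < (formMeasure 𝒜 θ).real B := ENNReal.toReal_pos hpos.ne' (measure_ne_top _ _)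
  refine IntegrableOn.of_bound (measure_lt_top _ _) ?_
    (max ((formMeasure 𝒜 θ).real B ^ (-s)) ((formMeasure 𝒜 θ).real U ^ (-s))) ?_
  · have hc : ContinuousOn (fun y => (formMeasure 𝒜 θ).real (join 𝒜 x y) ^ (-s)) (U \ B) := by
      intro y hy
      refine ContinuousWithinAt.congr_of_eventuallyEq (continuousWithinAt_const
        (b := (formMeasure 𝒜 θ).real (join 𝒜 x y) ^ (-s))) (mem_nhdsWithin_of_mem_nhds ?_) rfl
      filter_upwards [eventually_join_eq hU hy.1 (fun h => hy.2 (h ▸ hx))] with z hz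
      rw [hz]
    exact hc.aestronglyMeasurable hm
  · refine (ae_restrict_mem hm).mono fun y hy => ?_
    have h1 : (formMeasure 𝒜 θ).real B ≤ (formMeasure 𝒜 θ).real (join 𝒜 x y) :=
      measureReal_mono (subset_sInter fun C hC =>
        subset_of_mem_of_notMem hBall hx hU hC.1 hC.2.1 hC.2.2 hy.2)
    have h2 : (formMeasure 𝒜 θ).real (join 𝒜 x y) ≤ (formMeasure 𝒜 θ).real U :=
      measureReal_mono (join_subset hU.1.1 hU.1.2 hy.1)
    rw [Real.norm_of_nonneg (Real.rpow_nonneg measureReal_nonneg _)]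
    -- The sign of the exponent decides which end of the sandwich gives the bound.
    rcases le_total 0 (-s) with h | h
    · exact le_max_of_le_right (Real.rpow_le_rpow measureReal_nonneg h2 h)
    · exact le_max_of_le_left (Real.rpow_le_rpow_of_nonpos hb h1 h)

omit [BorelSpace X] [T2Space X] [IsManifold 𝓘(K, Fin n → K) ω X] [CompactSpace X] in
/-- The decomposition of the integrand of the Laplacian of a wavelet at a point of its support. -/
lemma IsWavelet.kernel_mul_sub_eq (hπ : IsNormalisedUniformizer π)
    (hχ : IsUnramifiedCharacter π χ) (hψ : IsWavelet 𝒜 π χ η ψ B) (s : ℝ) (hx : x ∈ B)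
    {U : Set X} (hU : IsGreatest {C : Set X | IsBall 𝒜 C ∧ x ∈ C} U) (y : X) :
    (kernel 𝒜 θ s x y : ℂ) * (ψ x - ψ y) =
      Uᶜ.indicator (fun _ => ψ x) y +
      (U \ B).indicator
        (fun y => (((formMeasure 𝒜 θ).real (join 𝒜 x y) ^ (-s) : ℝ) : ℂ) * ψ x) y +
      B.indicator
        (fun y => (((formMeasure 𝒜 θ).real B ^ (-s) : ℝ) : ℂ) * (ψ x - ψ y)) y := by
  have hBU : B ⊆ U := hU.2 ⟨hψ.isBall, hx⟩
  unfold kernel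
  by_cases hyU : y ∈ U
  · rw [if_pos ((hasJoin_iff_mem hU).2 hyU)]
    by_cases hyB : y ∈ B
    · simp only [mem_compl_iff, hyU, not_true_eq_false, not_false_eq_true, indicator_of_notMem,
        Set.mem_sdiff, hyB, and_false, indicator_of_mem, zero_add]
      -- Where the join is smaller than `B`, the difference `ψ x - ψ y` vanishes, so the value of
      -- the kernel is irrelevant.
      rcases hψ.join_eq_or_eq hπ hχ hU hx hyB with h | h
      · rw [h]
      · rw [h, sub_self, mul_zero, mul_zero]
    · simp [hyU, hyB, hψ.eq_zero hyB]
  · have hyB : y ∉ B := fun h => hyU (hBU h)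
    rw [if_neg (fun h => hyU ((hasJoin_iff_mem hU).1 h))]
    simp [hyU, hyB, hψ.eq_zero hyB]

lemma IsWavelet.integrable_and_laplacian_of_mem (hπ : IsNormalisedUniformizer π)
    (hχ : IsUnramifiedCharacter π χ) (hη : IsLift η) (h𝒜 : IsEqualisingAtlas 𝒜)
    (hθ : IsAnalyticForm θ) (hθ0 : ∀ x, θ x ≠ 0) (hψ : IsWavelet 𝒜 π χ η ψ B)
    (hB : HasConstantDensity 𝒜 θ B) (s : ℝ) (hx : x ∈ B) {U : Set X}
    (hU : IsGreatest {C : Set X | IsBall 𝒜 C ∧ x ∈ C} U) :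
    Integrable (fun y => (kernel 𝒜 θ s x y : ℂ) * (ψ x - ψ y)) (formMeasure 𝒜 θ) ∧
      laplacian 𝒜 θ s ψ x =
        (((formMeasure 𝒜 θ).real Uᶜ +
          (∫ y in U \ B, (formMeasure 𝒜 θ).real (join 𝒜 x y) ^ (-s) ∂(formMeasure 𝒜 θ)) +
          (formMeasure 𝒜 θ).real B ^ (1 - s) : ℝ) : ℂ) * ψ x := by
  have := formMeasure_isFiniteMeasure h𝒜 hθ
  have hpos := formMeasure_ball_pos h𝒜 hθ hθ0 hψ.isBall hψ.nonempty hB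
  have hb : 0 < (formMeasure 𝒜 θ).real B := ENNReal.toReal_pos hpos.ne' (measure_ne_top _ _)
  have hmU : MeasurableSet U := hU.1.1.isOpen.measurableSet
  have hmB : MeasurableSet B := hψ.isBall.isOpen.measurableSet
  have hψc : Continuous ψ := (hψ.isLocallyConstant hπ.ne_zero hχ).continuous
  have hψi : Integrable ψ (formMeasure 𝒜 θ) := by
    obtain ⟨C, hC⟩ := isCompact_univ.exists_bound_of_continuousOn hψc.continuousOn
    exact Integrable.of_bound hψc.aestronglyMeasurable C (ae_of_all _ fun x => hC x (mem_univ x))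
  have hJ := integrableOn_join_rpow h𝒜 hθ hψ.isBall hpos s hx hU
  have i1 : Integrable (Uᶜ.indicator fun _ => ψ x) (formMeasure 𝒜 θ) :=
    (integrable_const _).indicator hmU.compl
  have i2 : Integrable ((U \ B).indicator
      fun y => (((formMeasure 𝒜 θ).real (join 𝒜 x y) ^ (-s) : ℝ) : ℂ) * ψ x)
      (formMeasure 𝒜 θ) := by
    rw [integrable_indicator_iff (hmU.diff hmB)]
    exact (hJ.ofReal (𝕜 := ℂ)).mul_const _
  have i3 : Integrable (B.indicator
      fun y => (((formMeasure 𝒜 θ).real B ^ (-s) : ℝ) : ℂ) * (ψ x - ψ y))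
      (formMeasure 𝒜 θ) :=
    (((integrable_const _).sub hψi).const_mul _).indicator hmB
  unfold laplacian
  simp only [hψ.kernel_mul_sub_eq hπ hχ s hx hU]
  refine ⟨(i1.add i2).add i3, ?_⟩
  refine (integral_add (i1.add i2) i3).trans ?_
  -- In the last piece mean zero removes `ψ y`, leaving `μ(B) ^ (-s) * μ(B) * ψ x`.
  rw [integral_add' i1 i2, integral_indicator hmU.compl,
    integral_indicator (hmU.diff hmB), integral_indicator hmB, setIntegral_const,
    integral_mul_const, integral_complex_ofReal, integral_const_mul,
    integral_sub (integrable_const _) hψi.integrableOn, setIntegral_const,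
    hψ.setIntegral_eq_zero hπ.ne_zero hχ hη h𝒜 hθ hB, sub_zero, sub_eq_neg_add 1 s,
    Real.rpow_add_one hb.ne', Complex.real_smul, Complex.real_smul]
  push_cast
  ring

lemma IsWavelet.integrable_and_laplacian_of_notMem (hπ0 : π ≠ 0)
    (hχ : IsUnramifiedCharacter π χ) (hη : IsLift η) (h𝒜 : IsEqualisingAtlas 𝒜)
    (hθ : IsAnalyticForm θ) (hψ : IsWavelet 𝒜 π χ η ψ B)
    (hB : HasConstantDensity 𝒜 θ B) (s : ℝ)
    (hV : ∀ x ∈ B, IsGreatest {C : Set X | IsBall 𝒜 C ∧ x ∈ C} (V x)) (hx : x ∉ B) :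
    Integrable (fun y => (kernel 𝒜 θ s x y : ℂ) * (ψ x - ψ y)) (formMeasure 𝒜 θ) ∧
      laplacian 𝒜 θ s ψ x = 0 := by
  have := formMeasure_isFiniteMeasure h𝒜 hθ
  obtain ⟨b, hb⟩ := hψ.nonempty
  have hψc : Continuous ψ := (hψ.isLocallyConstant hπ0 hχ).continuous
  have hψi : Integrable ψ (formMeasure 𝒜 θ) := by
    obtain ⟨C, hC⟩ := isCompact_univ.exists_bound_of_continuousOn hψc.continuousOn
    exact Integrable.of_bound hψc.aestronglyMeasurable C (ae_of_all _ fun x => hC x (mem_univ x))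
  have hint : ∫ y, ψ y ∂(formMeasure 𝒜 θ) = 0 := by
    rw [← setIntegral_eq_integral_of_forall_compl_eq_zero (s := B) fun y hy => hψ.eq_zero hy]
    exact hψ.setIntegral_eq_zero hπ0 hχ hη h𝒜 hθ hB
  -- The kernel can be frozen at the base point `b`: it is constant for `y ∈ B`, and elsewhere both
  -- sides are zero.
  have heq : (fun y => (kernel 𝒜 θ s x y : ℂ) * (ψ x - ψ y)) =
      fun y => -(kernel 𝒜 θ s x b : ℂ) * ψ y := by
    funext y
    rw [hψ.eq_zero hx]
    by_cases hy : y ∈ B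
    · have hk : kernel 𝒜 θ s x y = kernel 𝒜 θ s x b := by
        have h1 : HasJoin 𝒜 x y ↔ HasJoin 𝒜 x b := by
          rw [hasJoin_comm, hasJoin_iff_of_notMem hψ.isBall hV hy hb hx, hasJoin_comm]
        have h2 : join 𝒜 x y = join 𝒜 x b := by
          rw [join_comm, join_eq_of_notMem hψ.isBall hV hy hb hx, join_comm]
        rw [kernel, kernel, h2]
        classical exact if_congr h1 rfl rfl
      rw [hk]
      ring
    · rw [hψ.eq_zero hy]
      ring
  unfold laplacian
  rw [heq]
  exact ⟨hψi.const_mul _, by rw [integral_const_mul, hint, mul_zero]⟩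

end Wavelet

end PadicManifold

/-! ### The eigenvalue equation. -/

open PadicManifold in
theorem proposition3p2 {K : Type*} [NontriviallyNormedField K] [IsUltrametricDist K]
    [ProperSpace K] [MeasurableSpace K] [BorelSpace K] {n : ℕ}
    {X : Type*} [TopologicalSpace X] [T2Space X] [CompactSpace X]
    [MeasurableSpace X] [BorelSpace X]
    [ChartedSpace (Fin n → K) X] [IsManifold 𝓘(K, Fin n → K) ω X]
    (π : K) (hπ : PadicManifold.IsNormalisedUniformizer π)
    (χ : AddChar K Circle) (hχ : PadicManifold.IsUnramifiedCharacter π χ)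
    (η : (Fin n → PadicManifold.Residue K) → (Fin n → PadicManifold.Integers K))
    (hη : PadicManifold.IsLift η)
    (𝒜 : Set (OpenPartialHomeomorph X (Fin n → K))) (h𝒜 : PadicManifold.IsEqualisingAtlas 𝒜)
    (θ : PadicManifold.TopForm K n X) (hθ : PadicManifold.IsAnalyticForm θ)
    (hθ0 : ∀ x, θ x ≠ 0)
    (s : ℝ) (ψ : X → ℂ) (B : Set X) (hψ : PadicManifold.IsWavelet 𝒜 π χ η ψ B)
    (hB : PadicManifold.HasConstantDensity 𝒜 θ B)
    (U : X → Set X)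
    (hU : ∀ x ∈ B, IsGreatest {C : Set X | PadicManifold.IsBall 𝒜 C ∧ x ∈ C} (U x)) :
    ∃ l : ℝ, PadicManifold.IsEigenfunction 𝒜 θ s ψ (l : ℂ) ∧
      ∀ x ∈ B,
        IntegrableOn
          (fun y => (PadicManifold.formMeasure 𝒜 θ).real (PadicManifold.join 𝒜 x y) ^ (-s))
          (U x \ B) (PadicManifold.formMeasure 𝒜 θ) ∧
        l = (PadicManifold.formMeasure 𝒜 θ).real (U x)ᶜ
          + (∫ y in U x \ B,
              (PadicManifold.formMeasure 𝒜 θ).real (PadicManifold.join 𝒜 x y) ^ (-s)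
                ∂(PadicManifold.formMeasure 𝒜 θ))
          + (PadicManifold.formMeasure 𝒜 θ).real B ^ (1 - s) := by
  obtain ⟨b, hb⟩ := hψ.nonempty
  have hJ : ∀ x ∈ B, MeasureTheory.IntegrableOn
      (fun y => (formMeasure 𝒜 θ).real (join 𝒜 x y) ^ (-s)) (U x \ B) (formMeasure 𝒜 θ) :=
    fun x hx => integrableOn_join_rpow h𝒜 hθ hψ.isBall
      (formMeasure_ball_pos h𝒜 hθ hθ0 hψ.isBall hψ.nonempty hB) s hx (hU x hx)
  -- The formula does not depend on the point: the largest balls coincide throughout `B`, and so do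
  -- the joins with a fixed point outside `B`.
  have hl : ∀ x ∈ B, (formMeasure 𝒜 θ).real (U b)ᶜ
      + (∫ y in U b \ B, (formMeasure 𝒜 θ).real (join 𝒜 b y) ^ (-s) ∂(formMeasure 𝒜 θ))
      + (formMeasure 𝒜 θ).real B ^ (1 - s) = (formMeasure 𝒜 θ).real (U x)ᶜ
      + (∫ y in U x \ B, (formMeasure 𝒜 θ).real (join 𝒜 x y) ^ (-s) ∂(formMeasure 𝒜 θ))
      + (formMeasure 𝒜 θ).real B ^ (1 - s) := by
    intro x hx
    rw [eq_of_isGreatest hψ.isBall hU hb hx]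
    congr 2
    refine MeasureTheory.setIntegral_congr_fun ((hU x hx).1.1.isOpen.measurableSet.diff
      hψ.isBall.isOpen.measurableSet) fun y hy => ?_
    simp only [join_eq_of_notMem hψ.isBall hU hb hx hy.2]
  refine ⟨_, ⟨hψ.isLocallyConstant hπ.ne_zero hχ, ?_, fun x => ?_, fun x => ?_⟩,
    fun x hx => ⟨hJ x hx, hl x hx⟩⟩
  · intro h
    have hb' := hb
    rw [← hψ.support_eq, h, Function.support_zero] at hb'
    exact hb'
  · by_cases hx : x ∈ B
    · exact (hψ.integrable_and_laplacian_of_mem hπ hχ hη h𝒜 hθ hθ0 hB s hx (hU x hx)).1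
    · exact (hψ.integrable_and_laplacian_of_notMem hπ.ne_zero hχ hη h𝒜 hθ hB s hU hx).1
  · by_cases hx : x ∈ B
    · rw [(hψ.integrable_and_laplacian_of_mem hπ hχ hη h𝒜 hθ hθ0 hB s hx (hU x hx)).2, hl x hx]
    · rw [(hψ.integrable_and_laplacian_of_notMem hπ.ne_zero hχ hη h𝒜 hθ hB s hU hx).2,
        hψ.eq_zero hx, mul_zero]
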